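/- Let $\mathcal X=\mathcal Y=\mathbb R$. A data set with inputs in $\mathcal Z\in\{\mathcal X,\mathcal X^2\}$ is a finite sequence $D=(\mathbf x,\mathbf y)=((x_1,y_1),\dots,(x_n,y_n))$, $n\ge 0$, with $x_i\in\mathcal Z$, $y_i\in\mathcal Y$. Let $\mathcal D=\bigcup_{n\ge0}(\mathcal X\times\mathcal Y)^n$ and $\mathcal D_2=\bigcup_{n\ge0}(\mathcal X^2\times\mathcal Y)^n$ be the spaces of data sets with inputs in $\mathcal X$ and in $\mathcal X^2$, with the disjoint-union topology (that of the metric $\|\mathbf x-\mathbf x'\|_2+\|\mathbf y-\mathbf y'\|_2$ between data sets of equal size, and $\infty$ between data sets of different sizes). For a translation $\tau\in\mathcal Z$ write $D+\tau=((x_1+\tau,y_1),\dots,(x_n+\tau,y_n))$, and $\operatorname{dup}(D)=(((x_1,x_1),y_1),\dots,((x_n,x_n),y_n))\in\mathcal D_2$ for $D\in\mathcal D$. Spaces $C(\mathcal X^2,\mathcal Y)$ of continuous functions carry the topology of compact convergence, and $C_{\mathrm{psd}}(\mathcal X^2,\mathcal Y)\subseteq C(\mathcal X^2,\mathcal Y)$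 is the subspace of (symmetric) positive semi-definite functions. For $\tau\in\mathcal X^2$ and a function $f$ on $\mathcal X^2$ let $\mathsf T_\tau f=f(\cdot-\tau)$, applied componentwise to tuples of functions. Let $e_\perp=(1,-1)/\sqrt2$ and $\tau_\perp=\langle e_\perp,\tau\rangle e_\perp$. Let $k\colon\mathcal D\to C_{\mathrm{psd}}(\mathcal X^2,\mathcal Y)$ be continuous and translation equivariant: $k(D+\tau)=\mathsf T_{(\tau,\tau)}k(D)$ for all $D\in\mathcal D$, $\tau\in\mathcal X$. Let $\tilde{\mathcal D}\subseteq\mathcal D$ be closed, closed under permutations of the observations and closed under translations, with bounded data set size, and of multiplicity $K\in\mathbb N$ (in each $D\in\tilde{\mathcal D}$ every input value occurs at most $K$ times). Suppose that $k(D)$, for $D\in\tilde{\mathcal D}$, does not depend on the order of the observations in $D$. Set $\phi\colon\mathcal Y\to\mathbb R^{K+1}$, $\phi(y)=(y^0,y^1,\dots,y^K)$. Let $h\in C(\mathcal X^2,\mathcal Y)$ be - $e_\perp$-discriminating: $\mathsf T_{\tau_1}h\ne\mathsf T_{\tau_2}h$ for all $\tau_1,\tau_2\in\mathcal X^2$ with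 $(\tau_1)_\perp\neq(\tau_2)_\perp$; and - invariant under diagonal translations: $\mathsf T_{(t,t)}h=h$ for all $t\in\mathcal X$. For a continuous $\psi\colon\mathcal X^2\to\mathbb R$ put, for $D\in\mathcal D$ and $D'\in\mathcal D_2$, $$E(D)=\begin{bmatrix}\sum_{i=1}^{n}\phi(y_i)\,\psi(\cdot-(x_i,x_i))\\ h\end{bmatrix},\qquad E_2(D')=\begin{bmatrix}\sum_{i=1}^{n}\phi(y_i)\,\psi(\cdot-\mathbf x_i)\\ \mathsf T_{\mathbf x_{\mathrm c}}h\end{bmatrix},$$ where $\mathbf x_{\mathrm c}=\frac1n\sum_{i=1}^n\mathbf x_i$ is the mean of the inputs of $D'$ ($\mathbf x_{\mathrm c}=0$ if $n=0$), and let $\tilde{\mathcal D}_2=\{\operatorname{dup}(D)+\tau : D\in\tilde{\mathcal D},\ \tau\in\mathcal X^2\}$. Then there exist a continuous $\psi\colon\mathcal X^2\to\mathbb R$ and a real reproducing kernel Hilbert space $\mathbb H$ of functions on $\mathcal X^2$ with (stationary) reproducing kernel $(z,w)\mapsto\psi(z-w)$, such that $\mathbb H'=E_2(\tilde{\mathcal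 D}_2)$ is a closed subset of $\mathbb H^{K+1}\times C(\mathcal X^2,\mathcal Y)$, and a map $\rho$ into $C(\mathcal X^2,\mathcal Y)$, defined on the set $\{\mathsf T_\tau e: e\in\mathbb H',\ \tau\in\mathcal X^2\}$ of all translates of elements of $\mathbb H'$, such that - the restriction of $\rho$ to $\mathbb H'$ is continuous; - $\rho$ is translation equivariant: $\rho(\mathsf T_\tau e)=\mathsf T_\tau\rho(e)$ for all $\tau\in\mathcal X^2$ and all $e$ in its domain; and - for all $D\in\tilde{\mathcal D}$, $E(D)\in\mathbb H'$ and $k(D)=\rho(E(D))$. -/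

import Mathlib

namespace GNP

noncomputable section

/-- Data sets with inputs in `X` and real outputs: finite sequences `((x₁, y₁), …, (xₙ, yₙ))`,
`n ≥ 0`. The topology is the disjoint-union topology of the spaces `(X × ℝ)ⁿ`, i.e. the topology of
the metric which is `‖x - x'‖₂ + ‖y - y'‖₂` between data sets of the same size and `∞` between
data sets of different sizes; in particular the empty data set is an isolated point. -/
abbrev DataSet (X : Type) : Type := Σ n : ℕ, Fin n → X × ℝ

/-- The size of a data set. -/
def DataSet.size {X : Type} (D : DataSet X) : ℕ := D.1

/-- The `i`-th input of a data set. -/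
def DataSet.input {X : Type} (D : DataSet X) (i : Fin D.1) : X := (D.2 i).1

/-- The `i`-th output of a data set. -/
def DataSet.output {X : Type} (D : DataSet X) (i : Fin D.1) : ℝ := (D.2 i).2

/-- Reordering of the observations of a data set. -/
def DataSet.permute {X : Type} (D : DataSet X) (σ : Equiv.Perm (Fin D.1)) : DataSet X :=
  ⟨D.1, fun i => D.2 (σ i)⟩

/-- `D + τ`: all inputs are translated by `τ`. -/
def DataSet.translate {X : Type} [Add X] (D : DataSet X) (τ : X) : DataSet X :=
  ⟨D.1, fun i => (D.input i + τ, D.output i)⟩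

/-- Duplication of the inputs: `x_i` becomes `(x_i, x_i)`. -/
def DataSet.duplicate (D : DataSet ℝ) : DataSet (ℝ × ℝ) :=
  ⟨D.1, fun i => ((D.input i, D.input i), D.output i)⟩

/-- The mean `x_c` of the inputs; it is `0` for the empty data set (where the sum is empty). -/
def DataSet.centroid (D : DataSet (ℝ × ℝ)) : ℝ × ℝ := (D.1 : ℝ)⁻¹ • ∑ i, D.input i

/-- The collection `S` has multiplicity (at most) `K`: in no data set of `S` does an input value
occur more than `K` times. -/
def HasMultiplicity (S : Set (DataSet ℝ)) (K : ℕ) : Prop :=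
  ∀ D ∈ S, ∀ x : ℝ, {i : Fin D.1 | D.input i = x}.ncard ≤ K

/-- The duplicated data sets of `S`, translated by arbitrary vectors of `ℝ × ℝ`. -/
def duplicated (S : Set (DataSet ℝ)) : Set (DataSet (ℝ × ℝ)) :=
  {D' | ∃ D ∈ S, ∃ τ : ℝ × ℝ, D' = D.duplicate.translate τ}

/-- A function of two real arguments is positive semi-definite if all its Gram matrices are
(symmetric and) positive semi-definite. -/
def IsPSD (f : C(ℝ × ℝ, ℝ)) : Prop :=
  ∀ (n : ℕ) (x : Fin n → ℝ), (Matrix.of fun i j => f (x i, x j)).PosSemidef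

/-- Continuous positive semi-definite functions on `ℝ × ℝ`, with the topology of compact
convergence (the compact-open topology). -/
abbrev PSDFun : Type := {f : C(ℝ × ℝ, ℝ) // IsPSD f}

/-- The shift operator `(T_τ f)(z) = f (z - τ)` on continuous functions. -/
def shift (τ : ℝ × ℝ) (f : C(ℝ × ℝ, ℝ)) : C(ℝ × ℝ, ℝ) :=
  ⟨fun z => f (z - τ), by fun_prop⟩

/-- The unit vector `(1, -1) / √2`. -/
def ePerp : ℝ × ℝ := (√2)⁻¹ • ((1, -1) : ℝ × ℝ)

/-- The component `⟨e_⊥, τ⟩ e_⊥` of `τ` along `e_⊥`. -/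
def perp (τ : ℝ × ℝ) : ℝ × ℝ := (ePerp.1 * τ.1 + ePerp.2 * τ.2) • ePerp

/-- `h` is `e_⊥`-discriminating. -/
def IsPerpDiscriminating (h : C(ℝ × ℝ, ℝ)) : Prop :=
  ∀ τ₁ τ₂ : ℝ × ℝ, perp τ₁ ≠ perp τ₂ → shift τ₁ h ≠ shift τ₂ h

/-- `h` is invariant with respect to diagonal translations. -/
def IsDiagonallyInvariant (h : C(ℝ × ℝ, ℝ)) : Prop :=
  ∀ t : ℝ, shift (t, t) h = h

/-- `φ(y) = (y⁰, y¹, …, y^K)`. -/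
def powers (K : ℕ) (y : ℝ) : Fin (K + 1) → ℝ := fun j => y ^ (j : ℕ)

section Encoding

variable (H : Type) [NormedAddCommGroup H] [InnerProductSpace ℝ H] [CompleteSpace H]
  [RKHS ℝ H (ℝ × ℝ) ℝ]

/-- The space `H^(K+1) × C(ℝ × ℝ, ℝ)` in which data sets are encoded. -/
abbrev Code (H : Type) (K : ℕ) : Type := (Fin (K + 1) → H) × C(ℝ × ℝ, ℝ)

/-- The reproducing kernel of `H` is the stationary kernel `(z, w) ↦ ψ (z - w)`. -/
def HasStationaryKernel (ψ : C(ℝ × ℝ, ℝ)) : Prop :=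
  ∀ z w : ℝ × ℝ, RKHS.kernel H z w 1 = ψ (z - w)

/-- The element `∑ i, φ(y_i) ψ(· - x_i)` of `H^(K+1)`, where `ψ(· - x) = kerFun H x 1` is the
kernel section of `H` at `x` (see `embed_apply`). -/
def embed (K : ℕ) (D : DataSet (ℝ × ℝ)) : Fin (K + 1) → H :=
  fun j => ∑ i, powers K (D.output i) j • RKHS.kerFun H (D.input i) 1

theorem embed_apply {ψ : C(ℝ × ℝ, ℝ)} (hψ : HasStationaryKernel H ψ) (K : ℕ)
    (D : DataSet (ℝ × ℝ)) (j : Fin (K + 1)) (z : ℝ × ℝ) :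
    embed H K D j z = ∑ i, powers K (D.output i) j * ψ (z - D.input i) := by
  have key : ∀ f : H, f z = RKHS.coeCLM ℝ f z := fun _ => rfl
  rw [key, embed, map_sum, Finset.sum_apply]
  refine Finset.sum_congr rfl fun i _ => ?_
  rw [map_smul, Pi.smul_apply, ← key, RKHS.kerFun_apply, hψ, smul_eq_mul]

/-- The encoding `E(x, y) = (∑ i, φ(y_i) ψ(· - (x_i, x_i)), h)` of data sets with real inputs. -/
def encode (h : C(ℝ × ℝ, ℝ)) (K : ℕ) (D : DataSet ℝ) : Code H K :=
  (embed H K D.duplicate, h)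

/-- The encoding `E₂(x, y) = (∑ i, φ(y_i) ψ(· - x_i), T_{x_c} h)` of data sets with inputs in
`ℝ × ℝ`. -/
def encodeTwo (h : C(ℝ × ℝ, ℝ)) (K : ℕ) (D : DataSet (ℝ × ℝ)) : Code H K :=
  (embed H K D, shift D.centroid h)

/-- `e' = T_τ e`: every component of `e'`, as a function on `ℝ × ℝ`, is the corresponding
component of `e` shifted by `τ`. -/
def IsTranslate {H : Type} [NormedAddCommGroup H] [InnerProductSpace ℝ H]
    [RKHS ℝ H (ℝ × ℝ) ℝ] {K : ℕ} (τ : ℝ × ℝ) (e e' : Code H K) : Prop :=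
  (∀ j z, e'.1 j z = e.1 j (z - τ)) ∧ e'.2 = shift τ e.2

/-- All translates of the elements of `A`. -/
def translates {H : Type} [NormedAddCommGroup H] [InnerProductSpace ℝ H]
    [RKHS ℝ H (ℝ × ℝ) ℝ] {K : ℕ} (A : Set (Code H K)) : Set (Code H K) :=
  {e' | ∃ e ∈ A, ∃ τ : ℝ × ℝ, IsTranslate τ e e'}

/-- `ρ` is translation equivariant on `A`: `ρ (T_τ e) = T_τ (ρ e)` whenever `e, T_τ e ∈ A`. -/
def IsEquivariantOn {H : Type} [NormedAddCommGroup H] [InnerProductSpace ℝ H]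
    [RKHS ℝ H (ℝ × ℝ) ℝ] {K : ℕ} (ρ : Code H K → C(ℝ × ℝ, ℝ)) (A : Set (Code H K)) : Prop :=
  ∀ e ∈ A, ∀ e' ∈ A, ∀ τ : ℝ × ℝ, IsTranslate τ e e' → ρ e' = shift τ (ρ e)

end Encoding

end

end GNP

/-!
A code `(∑ i, φ(y_i) ψ(· - z_i), T_τ h)` determines the data set it comes from up to permutations
and up to a joint diagonal translation, so `T_τ E(D) ↦ T_τ k(D)` is a well-defined and equivariant
map `ρ` (`shift_eq_of_code_eq`). Here the kernel sections of `ψ` are linearly independent, hence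
the coefficient at an input is the vector of power sums of the outputs observed there; since there
are at most `K` of these, Newton's identities recover them (`exists_equiv_of_embed_eq`). For the
empty data set the translation is recovered from `h`, up to diagonal translations, which do not
change `k(∅)`.

Closedness of `H'` and continuity of `ρ` on `H'` both follow from a properness statement
(`exists_lift_of_ultrafilter`): an ultrafilter of codes that converges lifts to data sets and
translations that converge. Sizes are bounded and hence constant along the ultrafilter, and one
input is normalised to zero. The inputs stay bounded because `ψ` has compact support. For `K ≥ 2`
the outputs stay bounded because `∑ i, y_i² ψ(· - z_i)` dominates `y_i² ψ(0)` at `z_i`.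

For `K = 1` only `∑ i, y_i ψ(· - z_i)` is available, and outputs of opposite sign at colliding
inputs could cancel: for a fixed `ψ` there may be divergent outputs whose codes converge. For this
reason `ψ` is adapted to the collection `S`. Multiplicity one and compactness give scales `δ m > 0`
that separate the inputs of those data sets of `S` whose inputs and outputs are at most
`2 ^ (m + 1)` (`exists_scales`). With a bump `ψ₁` of positive type and supported in the unit ball,
the function `ψ = ∑ m, 2⁻ᵐ ψ₁(· / δ m)` has kernel matrices bounded below by `2⁻ᵐ` on
`δ m`-separated points (`exists_profile`). If the largest output `y` is in `[2 ^ m, 2 ^ (m + 1))`,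
then the squared norm of `∑ i, y_i ψ(· - z_i)` is at least `2⁻ᵐ y² ≥ y`, which bounds `y`
(`abs_output_le_of_separated`). The same lower bounds yield the linear independence of the kernel
sections, as `δ m → 0`. For `K = 0` all data sets are empty.
-/

namespace GNP

open MeasureTheory Filter Topology

/-! ### Stationary kernels of positive type -/

/-- A real function `ψ` on `ℝ × ℝ` is of positive type if `(z, w) ↦ ψ (z - w)` is a symmetric
positive semi-definite kernel. Points and coefficients are given as finite families, with
repetitions allowed. -/
structure IsPositiveType (ψ : ℝ × ℝ → ℝ) : Prop where
  even : ∀ z, ψ (-z) = ψ z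
  nonneg : ∀ {ι : Type} (s : Finset ι) (z : ι → ℝ × ℝ) (c : ι → ℝ),
    0 ≤ ∑ i ∈ s, ∑ j ∈ s, c i * c j * ψ (z i - z j)

theorem IsPositiveType.le_zero {ψ : ℝ × ℝ → ℝ} (hψ : IsPositiveType ψ) (z : ℝ × ℝ) :
    ψ z ≤ ψ 0 := by
  have := hψ.nonneg (Finset.univ : Finset (Fin 2)) ![z, 0] ![1, -1]
  simp [Fin.sum_univ_two, hψ.even] at this
  linarith

theorem IsPositiveType.comp_smul {ψ : ℝ × ℝ → ℝ} (hψ : IsPositiveType ψ) (r : ℝ) :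
    IsPositiveType fun z => ψ (r • z) where
  even z := by rw [smul_neg, hψ.even]
  nonneg s z c := by simpa only [smul_sub] using hψ.nonneg s (fun i => r • z i) c

/-- The autocorrelation `z ↦ ∫ u (s - z) u (s) ds` of a continuous function with compact support
is of positive type: its quadratic forms are `∫ (∑ i, c i u (s - z i))² ds`. -/
theorem isPositiveType_autocorrelation {u : ℝ × ℝ → ℝ} (hu : Continuous u)
    (hcu : HasCompactSupport u) : IsPositiveType fun z => ∫ s, u (s - z) * u s := by
  have key : ∀ z w : ℝ × ℝ, ∫ s, u (s - (z - w)) * u s = ∫ s, u (s - z) * u (s - w) := by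
    intro z w
    rw [← integral_sub_right_eq_self (fun s => u (s - (z - w)) * u s) w]
    refine integral_congr_ae (.of_forall fun s => ?_)
    simp only
    congr 2
    abel
  refine ⟨fun z => ?_, fun s z c => ?_⟩
  · have h1 := key 0 z
    simp only [zero_sub, sub_zero] at h1
    rw [h1]
    simp only [mul_comm]
  · have hint : ∀ z w : ℝ × ℝ, Integrable fun s => u (s - z) * u (s - w) := by
      intro z w
      refine Continuous.integrable_of_hasCompactSupport (by fun_prop) ?_
      exact HasCompactSupport.mul_right (hcu.comp_homeomorph (Homeomorph.subRight z))
    have hsq : ∀ t : ℝ × ℝ, ∑ i ∈ s, ∑ j ∈ s, c i * c j * (u (t - z i) * u (t - z j))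
        = (∑ i ∈ s, c i * u (t - z i)) ^ 2 := by
      intro t
      rw [sq, Finset.sum_mul_sum]
      refine Finset.sum_congr rfl fun i _ => Finset.sum_congr rfl fun j _ => by ring
    have : ∑ i ∈ s, ∑ j ∈ s, c i * c j * ∫ t, u (t - (z i - z j)) * u t
        = ∫ t, (∑ i ∈ s, c i * u (t - z i)) ^ 2 := by
      simp only [key, ← hsq, ← integral_const_mul]
      rw [integral_finsetSum]
      · refine Finset.sum_congr rfl fun i _ => ?_
        rw [integral_finsetSum]
        exact fun j _ => (hint _ _).const_mul _
      · exact fun i _ => integrable_finsetSum _ fun j _ => (hint _ _).const_mul _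
    rw [this]
    exact integral_nonneg fun t => sq_nonneg _

/-- There is a normalised continuous nonnegative function of positive type supported in the unit
ball. -/
theorem exists_bump : ∃ ψ : ℝ × ℝ → ℝ, Continuous ψ ∧ IsPositiveType ψ ∧ (∀ z, 0 ≤ ψ z) ∧
    ψ 0 = 1 ∧ ∀ z, 1 ≤ ‖z‖ → ψ z = 0 := by
  let u : ℝ × ℝ → ℝ := fun s => max 0 (1 / 2 - ‖s‖)
  have hu : Continuous u := by fun_prop
  have hu0 : ∀ s, 0 ≤ u s := fun s => le_max_left _ _
  have hsupp : ∀ s, 1 / 2 ≤ ‖s‖ → u s = 0 := fun s hs => max_eq_left (by linarith)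
  have hcu : HasCompactSupport u :=
    HasCompactSupport.intro (isCompact_closedBall (0 : ℝ × ℝ) (1 / 2)) fun s hs => by
      refine hsupp s ?_
      simp only [mem_closedBall_zero_iff, not_le] at hs
      exact hs.le
  have hpos : 0 < ∫ s, u (s - 0) * u s := by
    refine Continuous.integral_pos_of_hasCompactSupport_nonneg_nonzero (x := 0) (by fun_prop) ?_
      (fun s => mul_nonneg (hu0 _) (hu0 _)) ?_
    · exact hcu.mul_left
    · simp [u]
  have hcont : Continuous fun z : ℝ × ℝ => ∫ s, u (s - z) * u s := by
    have : (fun z : ℝ × ℝ => ∫ s, u (s - z) * u s)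
        = fun z => ∫ s in Metric.closedBall 0 (1 / 2), u (s - z) * u s := by
      funext z
      rw [setIntegral_eq_integral_of_forall_compl_eq_zero]
      intro s hs
      simp only [mem_closedBall_zero_iff, not_le] at hs
      rw [hsupp s hs.le, mul_zero]
    rw [this]
    exact continuous_parametric_integral_of_continuous (by fun_prop)
      (isCompact_closedBall (0 : ℝ × ℝ) (1 / 2))
  have hPT := isPositiveType_autocorrelation hu hcu
  refine ⟨fun z => (∫ s, u (s - 0) * u s)⁻¹ * ∫ s, u (s - z) * u s, by fun_prop,
    ⟨fun z => ?_, fun s z c => ?_⟩, fun z => ?_, inv_mul_cancel₀ hpos.ne', fun z hz => ?_⟩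
  · simp only [hPT.even z]
  · have := mul_nonneg (inv_nonneg.2 hpos.le) (hPT.nonneg s z c)
    simpa only [Finset.mul_sum, mul_left_comm] using this
  · exact mul_nonneg (inv_nonneg.2 hpos.le)
      (integral_nonneg fun s => mul_nonneg (hu0 _) (hu0 _))
  · have : ∀ s, u (s - z) * u s = 0 := by
      intro s
      by_cases hs : 1 / 2 ≤ ‖s‖
      · rw [hsupp s hs, mul_zero]
      · rw [hsupp (s - z), zero_mul]
        have := norm_sub_norm_le z s
        rw [norm_sub_rev] at this
        linarith
    simp [this]

/-- Summing scaled bumps `2⁻ᵐ ψ₁ (z / δ m)` gives a function of positive type whose kernel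
matrices are at least `2⁻ᵐ` on `δ m`-separated points, because there the `m`-th summand contributes
a multiple of the identity matrix. The scales `δ m` may tend to zero arbitrarily fast. -/
theorem exists_profile (δ : ℕ → ℝ) (hδ : ∀ m, 0 < δ m) (hδ1 : ∀ m, δ m ≤ 1) :
    ∃ ψ : C(ℝ × ℝ, ℝ), IsPositiveType ψ ∧ (∀ z, 0 ≤ ψ z) ∧ 0 < ψ 0 ∧
      (∀ z, 1 ≤ ‖z‖ → ψ z = 0) ∧
      ∀ (m : ℕ) {ι : Type} (s : Finset ι) (z : ι → ℝ × ℝ) (c : ι → ℝ),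
        (∀ i ∈ s, ∀ j ∈ s, i ≠ j → δ m ≤ ‖z i - z j‖) →
        (1 / 2) ^ m * ∑ i ∈ s, c i ^ 2 ≤ ∑ i ∈ s, ∑ j ∈ s, c i * c j * ψ (z i - z j) := by
  obtain ⟨φ, hφc, hφ, hφ0, hφ1, hφs⟩ := exists_bump
  let a : ℕ → ℝ × ℝ → ℝ := fun m z => (1 / 2) ^ m * φ ((δ m)⁻¹ • z)
  have ha0 : ∀ m z, 0 ≤ a m z := fun m z => mul_nonneg (by positivity) (hφ0 _)
  have ha1 : ∀ m z, a m z ≤ (1 / 2) ^ m := fun m z =>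
    mul_le_of_le_one_right (by positivity) (hφ1 ▸ hφ.le_zero _)
  have hsum : ∀ z, Summable fun m => a m z := fun z =>
    Summable.of_nonneg_of_le (fun m => ha0 m z) (fun m => ha1 m z) summable_geometric_two
  have hcont : Continuous fun z => ∑' m, a m z := by
    refine continuous_tsum (fun m => by fun_prop) summable_geometric_two fun m z => ?_
    rw [Real.norm_of_nonneg (ha0 m z)]
    exact ha1 m z
  have hquad : ∀ {ι : Type} (s : Finset ι) (z : ι → ℝ × ℝ) (c : ι → ℝ),
      HasSum (fun m => ∑ i ∈ s, ∑ j ∈ s, c i * c j * a m (z i - z j))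
        (∑ i ∈ s, ∑ j ∈ s, c i * c j * ∑' m, a m (z i - z j)) := fun s z c =>
    hasSum_sum fun i _ => hasSum_sum fun j _ => (hsum _).hasSum.mul_left _
  have hquad0 : ∀ {ι : Type} (s : Finset ι) (z : ι → ℝ × ℝ) (c : ι → ℝ) (m : ℕ),
      0 ≤ ∑ i ∈ s, ∑ j ∈ s, c i * c j * a m (z i - z j) := by
    intro ι s z c m
    have := mul_nonneg (show (0 : ℝ) ≤ (1 / 2) ^ m by positivity)
      ((hφ.comp_smul (δ m)⁻¹).nonneg s z c)
    simpa only [a, Finset.mul_sum, mul_left_comm] using this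
  refine ⟨⟨fun z => ∑' m, a m z, hcont⟩, ⟨fun z => ?_, fun s z c => ?_⟩, fun z => ?_, ?_,
    fun z hz => ?_, fun m ι s z c hz => ?_⟩
  · simp only [ContinuousMap.coe_mk, a]
    refine tsum_congr fun m => ?_
    rw [smul_neg, hφ.even]
  · exact (hquad s z c).nonneg (hquad0 s z c)
  · exact tsum_nonneg fun m => ha0 m z
  · refine (hsum 0).tsum_pos (fun m => ha0 m 0) 0 ?_
    simp [a, hφ1]
  · have : ∀ m, a m z = 0 := fun m => by
      have h1 : 1 ≤ ‖(δ m)⁻¹ • z‖ := by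
        rw [norm_smul, norm_inv, Real.norm_of_nonneg (hδ m).le]
        exact one_le_mul_of_one_le_of_one_le ((one_le_inv₀ (hδ m)).2 (hδ1 m)) hz
      simp [a, hφs _ h1]
    simp [this]
  · refine le_trans (le_of_eq ?_) (le_hasSum (hquad s z c) m fun m' _ => hquad0 s z c m')
    rw [Finset.mul_sum]
    refine Finset.sum_congr rfl fun i hi => ?_
    rw [Finset.sum_eq_single_of_mem i hi]
    · simp [a, hφ1]
      ring
    · intro j hj hji
      have h1 : 1 ≤ ‖(δ m)⁻¹ • (z i - z j)‖ := by
        rw [norm_smul, norm_inv, Real.norm_of_nonneg (hδ m).le, inv_mul_eq_div,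
          one_le_div (hδ m)]
        exact hz i hi j hj hji.symm
      simp [a, hφs _ h1]

/-! ### Kernel sections -/

/-- Every continuous function of positive type is the profile of a stationary reproducing kernel. -/
theorem exists_rkhs (ψ : C(ℝ × ℝ, ℝ)) (hψ : IsPositiveType ψ) :
    ∃ (H : Type) (_ : NormedAddCommGroup H) (_ : InnerProductSpace ℝ H) (_ : CompleteSpace H)
      (_ : RKHS ℝ H (ℝ × ℝ) ℝ), HasStationaryKernel H ψ := by
  let G : Matrix (ℝ × ℝ) (ℝ × ℝ) (ℝ →L[ℝ] ℝ) :=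
    .of fun z w => ψ (z - w) • 1
  have hG : G.PosSemidef := by
    have htfae := (RKHS.posSemidef_tfae (K := G)).out 0 2
    refine htfae.2 ⟨?_, fun v => ?_⟩
    · refine Matrix.ext fun z w => ?_
      simp only [G, Matrix.conjTranspose_apply, Matrix.of_apply, star_smul, star_one, star_trivial]
      rw [← hψ.even, neg_sub]
    · refine (hψ.nonneg v.support id v).trans_eq ?_
      simp only [Finsupp.sum, RCLike.re_to_real, G, Matrix.of_apply, id]
      refine Finset.sum_congr rfl fun i _ => Finset.sum_congr rfl fun j _ => ?_
      rw [← hψ.even, neg_sub]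
      simp
      ring
  have : Fact G.PosSemidef := ⟨hG⟩
  refine ⟨RKHS.OfKernel G, inferInstance, inferInstance, inferInstance, inferInstance,
    fun z w => ?_⟩
  rw [RKHS.OfKernel.kernel_ofKernel]
  simp [G]

section KernelSections

variable {H : Type} [NormedAddCommGroup H] [InnerProductSpace ℝ H] [CompleteSpace H]
  [RKHS ℝ H (ℝ × ℝ) ℝ] {ψ : C(ℝ × ℝ, ℝ)}

theorem inner_kerFun_kerFun (hψ : HasStationaryKernel H ψ) (z w : ℝ × ℝ) :
    inner ℝ (RKHS.kerFun H z 1) (RKHS.kerFun H w 1) = ψ (z - w) := by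
  rw [RKHS.kerFun_inner, RKHS.kerFun_apply, hψ]
  simp

theorem norm_sum_kerFun_sq (hψ : HasStationaryKernel H ψ) {ι : Type} (s : Finset ι)
    (z : ι → ℝ × ℝ) (c : ι → ℝ) :
    ‖∑ i ∈ s, c i • RKHS.kerFun H (z i) 1‖ ^ 2
      = ∑ i ∈ s, ∑ j ∈ s, c i * c j * ψ (z i - z j) := by
  rw [← real_inner_self_eq_norm_sq, sum_inner]
  refine Finset.sum_congr rfl fun i _ => ?_
  rw [inner_sum]
  refine Finset.sum_congr rfl fun j _ => ?_
  rw [real_inner_smul_left, real_inner_smul_right, inner_kerFun_kerFun hψ, mul_assoc]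

theorem abs_apply_le (hψ : HasStationaryKernel H ψ) (f : H) (z : ℝ × ℝ) :
    |f z| ≤ ‖f‖ * √(ψ 0) := by
  have h1 : inner ℝ f (RKHS.kerFun H z 1) = f z := by simp
  have h2 : ‖RKHS.kerFun H z (1 : ℝ)‖ = √(ψ 0) := by
    rw [← sub_self z, ← inner_kerFun_kerFun hψ, real_inner_self_eq_norm_sq,
      Real.sqrt_sq (norm_nonneg _)]
  rw [← h1, ← h2]
  exact abs_real_inner_le_norm _ _

theorem continuous_kerFun (hψ : HasStationaryKernel H ψ) :
    Continuous fun z : ℝ × ℝ => RKHS.kerFun H z (1 : ℝ) := by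
  refine continuous_iff_continuousAt.2 fun w => tendsto_iff_norm_sub_tendsto_zero.2 ?_
  have h1 : ∀ z : ℝ × ℝ, ‖RKHS.kerFun H z (1 : ℝ) - RKHS.kerFun H w 1‖
      = √(2 * ψ 0 - 2 * ψ (z - w)) := by
    intro z
    rw [← Real.sqrt_sq (norm_nonneg _), norm_sub_sq_real, ← real_inner_self_eq_norm_sq,
      ← real_inner_self_eq_norm_sq]
    simp only [inner_kerFun_kerFun hψ, sub_self]
    congr 1
    ring
  simp only [h1]
  have h2 : Continuous fun z => √(2 * ψ 0 - 2 * ψ (z - w)) := by fun_prop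
  simpa using h2.tendsto w

theorem embed_translate_apply (hψ : HasStationaryKernel H ψ) (K : ℕ) (D : DataSet (ℝ × ℝ))
    (τ z : ℝ × ℝ) (j : Fin (K + 1)) :
    embed H K (D.translate τ) j z = embed H K D j (z - τ) := by
  rw [embed_apply H hψ, embed_apply H hψ]
  refine Finset.sum_congr rfl fun i _ => ?_
  simp only [DataSet.translate, DataSet.input, DataSet.output, sub_sub, add_comm]

/-- If kernel matrices of separated points are bounded below at arbitrarily small scales, then
kernel sections at distinct points are linearly independent. -/
theorem linearIndependent_kerFun (hψ : HasStationaryKernel H ψ) {δ : ℕ → ℝ}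
    (hδ : Tendsto δ atTop (𝓝 0))
    (hlow : ∀ (m : ℕ) {ι : Type} (s : Finset ι) (z : ι → ℝ × ℝ) (c : ι → ℝ),
        (∀ i ∈ s, ∀ j ∈ s, i ≠ j → δ m ≤ ‖z i - z j‖) →
        (1 / 2) ^ m * ∑ i ∈ s, c i ^ 2 ≤ ∑ i ∈ s, ∑ j ∈ s, c i * c j * ψ (z i - z j)) :
    LinearIndependent ℝ fun z : ℝ × ℝ => RKHS.kerFun H z (1 : ℝ) := by
  rw [linearIndependent_iff']
  intro s c hc i hi
  obtain ⟨m, hm⟩ : ∃ m, ∀ x ∈ s, ∀ y ∈ s, x ≠ y → δ m ≤ ‖x - y‖ := by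
    refine Eventually.exists (f := atTop) ?_
    refine (Filter.eventually_all_finset s).2 fun x _ => (Filter.eventually_all_finset s).2
      fun y _ => ?_
    by_cases hxy : x = y
    · simp [hxy]
    · filter_upwards [hδ.eventually (gt_mem_nhds (norm_pos_iff.2 (sub_ne_zero.2 hxy)))] with m hm
        using fun _ => hm.le
  have h1 := hlow m s id c hm
  have h2 := norm_sum_kerFun_sq hψ s id c
  simp only [id] at h1 h2
  rw [← h2, hc, norm_zero] at h1
  have h3 : ∑ i ∈ s, c i ^ 2 ≤ 0 := by
    by_contra! h
    have : 0 < (1 / 2 : ℝ) ^ m * ∑ i ∈ s, c i ^ 2 := by positivity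
    linarith
  have h4 := (Finset.sum_eq_zero_iff_of_nonneg fun i _ => sq_nonneg (c i)).1
    (h3.antisymm (Finset.sum_nonneg fun i _ => sq_nonneg (c i))) i hi
  exact pow_eq_zero_iff two_ne_zero |>.1 h4

end KernelSections

/-! ### Injectivity of the encoding -/

/-- Two families whose first power sums agree, up to the cardinality of the index set, agree up to
order: by Newton's identities they have the same elementary symmetric functions. -/
theorem multiset_map_eq_of_power_sums {ι : Type} [Fintype ι] (a b : ι → ℝ)
    (hab : ∀ k ≤ Fintype.card ι, ∑ i, a i ^ k = ∑ i, b i ^ k) :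
    Finset.univ.val.map a = Finset.univ.val.map b := by
  have hesymm : ∀ k ≤ Fintype.card ι, (Finset.univ.val.map a).esymm k
      = (Finset.univ.val.map b).esymm k := by
    intro k
    induction k using Nat.strong_induction_on with
    | _ k ih =>
      intro hk
      rcases Nat.eq_zero_or_pos k with rfl | hpos
      · simp [Multiset.esymm]
      have newton : ∀ f : ι → ℝ, (k : ℝ) * (Finset.univ.val.map f).esymm k = (-1) ^ (k + 1) *
          ∑ p ∈ Finset.HasAntidiagonal.antidiagonal k with p.1 < k,
            (-1) ^ p.1 * (Finset.univ.val.map f).esymm p.1 * ∑ i, f i ^ p.2 := by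
        intro f
        have := congrArg (MvPolynomial.aeval f) (MvPolynomial.mul_esymm_eq_sum ι ℝ k)
        simpa [← MvPolynomial.aeval_esymm_eq_multiset_esymm ι ℝ, MvPolynomial.psum] using this
      have hk0 : (k : ℝ) ≠ 0 := by exact_mod_cast hpos.ne'
      refine mul_left_cancel₀ hk0 ?_
      rw [newton a, newton b]
      congr 1
      refine Finset.sum_congr rfl fun p hp => ?_
      simp only [Finset.mem_filter, Finset.HasAntidiagonal.mem_antidiagonal] at hp
      rw [ih p.1 hp.2 (by omega), hab p.2 (by omega)]
  have hprod : ((Finset.univ.val.map a).map fun t => Polynomial.X - Polynomial.C t).prod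
      = ((Finset.univ.val.map b).map fun t => Polynomial.X - Polynomial.C t).prod := by
    rw [Multiset.prod_X_sub_X_eq_sum_esymm, Multiset.prod_X_sub_X_eq_sum_esymm]
    simp only [Multiset.card_map, Finset.card_val, Finset.card_univ]
    refine Finset.sum_congr rfl fun k hk => ?_
    rw [hesymm k (by simpa [Nat.lt_succ_iff] using hk)]
  have := congrArg Polynomial.roots hprod
  rwa [Polynomial.roots_multiset_prod_X_sub_C, Polynomial.roots_multiset_prod_X_sub_C] at this

/-- Linear independence of kernel sections makes the encoding of data sets of multiplicity at most
`K` injective up to the order of the observations: the coefficients at an input `w` are the power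
sums, of orders `0` to `K`, of the at most `K` outputs observed at `w`. -/
theorem exists_equiv_of_embed_eq {H : Type} [NormedAddCommGroup H] [InnerProductSpace ℝ H]
    [CompleteSpace H] [RKHS ℝ H (ℝ × ℝ) ℝ]
    (hli : LinearIndependent ℝ fun z : ℝ × ℝ => RKHS.kerFun H z (1 : ℝ)) {K : ℕ}
    {D D' : DataSet (ℝ × ℝ)} (hmult : ∀ w, {i | D.input i = w}.ncard ≤ K)
    (hDD' : embed H K D = embed H K D') :
    ∃ e : Fin D.1 ≃ Fin D'.1, ∀ i, D'.2 (e i) = D.2 i := by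
  classical
  have hcoeff : ∀ k ≤ K, ∀ w, ∑ i : {i // D.input i = w}, D.output i ^ k
      = ∑ i : {i // D'.input i = w}, D'.output i ^ k := by
    intro k hk w
    have hcomb : ∀ E : DataSet (ℝ × ℝ), Finsupp.linearCombination ℝ
        (fun z : ℝ × ℝ => RKHS.kerFun H z (1 : ℝ))
        (∑ i, Finsupp.single (E.input i) (E.output i ^ k))
        = embed H K E ⟨k, Nat.lt_succ_of_le hk⟩ := by
      intro E
      simp [embed, powers]
    have heval : ∀ E : DataSet (ℝ × ℝ),
        (∑ i, Finsupp.single (E.input i) (E.output i ^ k) : ℝ × ℝ →₀ ℝ) w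
        = ∑ i : {i // E.input i = w}, E.output i ^ k := by
      intro E
      rw [Finsupp.finsetSum_apply]
      simp only [Finsupp.single_apply]
      rw [← Finset.sum_filter, ← Finset.sum_subtype_eq_sum_filter]
      simp
    rw [← heval D, ← heval D']
    refine DFunLike.congr_fun (hli ?_) w
    rw [hcomb, hcomb, hDD']
  have hfiber : ∀ p : (ℝ × ℝ) × ℝ, Nonempty ({i // D.2 i = p} ≃ {i // D'.2 i = p}) := by
    rintro ⟨w, v⟩
    have hcard := hcoeff 0 (Nat.zero_le _) w
    simp only [pow_zero, Finset.sum_const, Finset.card_univ, nsmul_eq_mul, mul_one,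
      Nat.cast_inj] at hcard
    have e := Fintype.equivOfCardEq hcard
    have hle : Fintype.card {i // D.input i = w} ≤ K := by
      refine le_trans (le_of_eq ?_) (hmult w)
      rw [← Nat.card_eq_fintype_card]
      rfl
    have hmap := multiset_map_eq_of_power_sums
      (fun i : {i // D.input i = w} => D.output i) (fun i => D'.output (e i)) fun k hk => by
        rw [hcoeff k (hk.trans hle) w]
        exact (e.sum_comp fun i : {i // D'.input i = w} => D'.output i ^ k).symm
    have hcount := congrArg (Multiset.count v) hmap
    rw [Multiset.count_map, Multiset.count_map] at hcount
    have hc : Fintype.card {i : {i // D.input i = w} // v = D.output i}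
        = Fintype.card {i : {i // D.input i = w} // v = D'.output (e i)} := by
      rw [Fintype.card_subtype, Fintype.card_subtype]
      exact hcount
    have hsplit : ∀ E : DataSet (ℝ × ℝ), Nonempty ({i // E.2 i = (w, v)} ≃
        {i : {i // E.input i = w} // v = E.output i}) := fun E =>
      ⟨(Equiv.subtypeEquivRight fun i => by
        rw [Prod.ext_iff, DataSet.input, DataSet.output, eq_comm (a := v)]).trans
        (Equiv.subtypeSubtypeEquivSubtypeInter (fun i => E.input i = w)
          (fun i => v = E.output i)).symm⟩
    obtain ⟨e₁⟩ := hsplit D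
    obtain ⟨e₂⟩ := hsplit D'
    exact ⟨e₁.trans ((Fintype.equivOfCardEq hc).trans
      ((e.subtypeEquiv fun i => Iff.rfl).trans e₂.symm))⟩
  exact ⟨Equiv.ofFiberEquiv fun p => (hfiber p).some, fun i => Equiv.ofFiberEquiv_map _ i⟩

/-! ### Shifts -/

theorem shift_shift (σ τ : ℝ × ℝ) (f : C(ℝ × ℝ, ℝ)) : shift σ (shift τ f) = shift (σ + τ) f := by
  ext z
  simp only [shift, ContinuousMap.coe_mk, sub_sub]

theorem shift_zero (f : C(ℝ × ℝ, ℝ)) : shift 0 f = f := by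
  ext z
  simp [shift]

theorem continuous_shift : Continuous fun p : (ℝ × ℝ) × C(ℝ × ℝ, ℝ) => shift p.1 p.2 := by
  refine ContinuousMap.continuous_of_continuous_uncurry _ ?_
  change Continuous fun q : ((ℝ × ℝ) × C(ℝ × ℝ, ℝ)) × (ℝ × ℝ) => q.1.2 (q.2 - q.1.1)
  fun_prop

theorem sub_eq_diag_of_perp_eq {τ τ' : ℝ × ℝ} (hτ : perp τ = perp τ') :
    ∃ t : ℝ, τ' = τ + (t, t) := by
  have h2 : (√2 : ℝ)⁻¹ ≠ 0 := by positivity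
  have h1 := congrArg Prod.fst hτ
  simp only [perp, ePerp, Prod.smul_fst, Prod.smul_snd, smul_eq_mul, mul_one] at h1
  have h3 := mul_right_cancel₀ h2 h1
  have h4 := mul_left_cancel₀ h2
    (show (√2 : ℝ)⁻¹ * (τ.1 - τ.2) = (√2)⁻¹ * (τ'.1 - τ'.2) by linarith)
  exact ⟨τ'.1 - τ.1, Prod.ext (by simp) (by simp; linarith)⟩

/-! ### Separation of inputs -/

section Separation

variable {S : Set (DataSet ℝ)}

/-- In a closed collection of data sets of bounded size and multiplicity one, the inputs of the
data sets with inputs and outputs in `[-B, B]` are uniformly separated, by compactness. -/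
theorem exists_separation (hS : IsClosed S) {N : ℕ} (hsize : ∀ D ∈ S, D.size ≤ N)
    (hmult : HasMultiplicity S 1) (B : ℝ) :
    ∃ δ > 0, ∀ D ∈ S, (∀ a, |D.input a| ≤ B ∧ |D.output a| ≤ B) →
      ∀ a b, a ≠ b → δ ≤ |D.input a - D.input b| := by
  -- For fixed size and fixed indices the distance attains a positive minimum on a compact set.
  have key : ∀ n ∈ Finset.range (N + 1), ∀ a b : Fin n, ∀ᶠ δ in 𝓝[>] (0 : ℝ),
      ∀ d : Fin n → ℝ × ℝ, (⟨n, d⟩ : DataSet ℝ) ∈ S → (∀ i, |(d i).1| ≤ B ∧ |(d i).2| ≤ B) →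
        a ≠ b → δ ≤ |(d a).1 - (d b).1| := by
    intro n _ a b
    by_cases hab : a = b
    · exact .of_forall fun δ d _ _ h => absurd hab h
    let C : Set (Fin n → ℝ × ℝ) := {d | (⟨n, d⟩ : DataSet ℝ) ∈ S} ∩
      Set.pi Set.univ fun _ => Set.Icc (-B) B ×ˢ Set.Icc (-B) B
    have hC : IsCompact C := (isCompact_univ_pi fun _ => isCompact_Icc.prod isCompact_Icc).inter_left
      (hS.preimage (continuous_sigmaMk (σ := fun n => Fin n → ℝ × ℝ)))
    have hmem : ∀ d : Fin n → ℝ × ℝ, (⟨n, d⟩ : DataSet ℝ) ∈ S →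
        (∀ i, |(d i).1| ≤ B ∧ |(d i).2| ≤ B) → d ∈ C := fun d hd hB =>
      ⟨hd, fun i _ => ⟨abs_le.1 (hB i).1, abs_le.1 (hB i).2⟩⟩
    rcases C.eq_empty_or_nonempty with hempty | hne
    · refine .of_forall fun δ d hd hB => ?_
      have := hmem d hd hB
      simp [hempty] at this
    · obtain ⟨d₀, hd₀, hmin⟩ := hC.exists_isMinOn hne
        (f := fun d => |(d a).1 - (d b).1|) (by fun_prop)
      have hpos : 0 < |(d₀ a).1 - (d₀ b).1| := by
        refine abs_pos.2 (sub_ne_zero.2 fun heq => hab ?_)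
        exact (Set.ncard_le_one (Set.toFinite _)).1 (hmult ⟨n, d₀⟩ hd₀.1 (d₀ b).1) a heq b rfl
      filter_upwards [Ioc_mem_nhdsGT hpos] with δ hδ d hd hB _
      exact hδ.2.trans (hmin (hmem d hd hB))
  have hall : ∀ᶠ δ in 𝓝[>] (0 : ℝ), ∀ n ∈ Finset.range (N + 1), ∀ a b : Fin n,
      ∀ d : Fin n → ℝ × ℝ, (⟨n, d⟩ : DataSet ℝ) ∈ S → (∀ i, |(d i).1| ≤ B ∧ |(d i).2| ≤ B) →
        a ≠ b → δ ≤ |(d a).1 - (d b).1| :=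
    (Filter.eventually_all_finset _).2 fun n hn => Filter.eventually_all.2 fun a =>
      Filter.eventually_all.2 fun b => key n hn a b
  obtain ⟨δ, hδ, hpos⟩ := (hall.and self_mem_nhdsWithin).exists
  refine ⟨δ, hpos, fun ⟨n, d⟩ hD hB a b hab => hδ n ?_ a b d hD hB hab⟩
  exact Finset.mem_range.2 (Nat.lt_succ_of_le (hsize _ hD))

/-- Scales for `exists_profile`: they tend to zero and, for multiplicity one, the `m`-th scale
separates the inputs of the data sets in `S` with inputs and outputs bounded by `2 ^ (m + 1)`. -/
theorem exists_scales (hS : IsClosed S) {N : ℕ} (hsize : ∀ D ∈ S, D.size ≤ N) {K : ℕ}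
    (hmult : HasMultiplicity S K) :
    ∃ δ : ℕ → ℝ, (∀ m, 0 < δ m) ∧ (∀ m, δ m ≤ 1) ∧ Tendsto δ atTop (𝓝 0) ∧
      (K = 1 → ∀ m, ∀ D ∈ S, (∀ a, |D.input a| ≤ 2 ^ (m + 1) ∧ |D.output a| ≤ 2 ^ (m + 1)) →
        ∀ a b, a ≠ b → δ m ≤ |D.input a - D.input b|) := by
  have h1 : ∀ m : ℕ, ∃ δ > 0, K = 1 → ∀ D ∈ S,
      (∀ a, |D.input a| ≤ 2 ^ (m + 1) ∧ |D.output a| ≤ 2 ^ (m + 1)) →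
        ∀ a b, a ≠ b → δ ≤ |D.input a - D.input b| := by
    intro m
    by_cases hK : K = 1
    · obtain ⟨δ, hδ, h⟩ := exists_separation hS hsize (hK ▸ hmult) (2 ^ (m + 1))
      exact ⟨δ, hδ, fun _ => h⟩
    · exact ⟨1, one_pos, fun h => absurd h hK⟩
  choose δ hδ h using h1
  have hpos : ∀ m : ℕ, (0 : ℝ) < 1 / ((m : ℝ) + 1) := fun m => by positivity
  refine ⟨fun m => min (δ m) (1 / ((m : ℝ) + 1)), fun m => lt_min (hδ m) (hpos m),
    fun m => (min_le_right _ _).trans ?_, ?_, fun hK m D hD hB a b hab =>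
      (min_le_left _ _).trans (h m hK D hD hB a b hab)⟩
  · rw [div_le_one (by positivity)]
    simp
  · exact squeeze_zero (fun m => (lt_min (hδ m) (hpos m)).le) (fun m => min_le_right _ _)
      tendsto_one_div_add_atTop_nhds_zero_nat

end Separation

/-! ### Bounds on inputs and outputs -/

section Bounds

variable {H : Type} [NormedAddCommGroup H] [InnerProductSpace ℝ H] [CompleteSpace H]
  [RKHS ℝ H (ℝ × ℝ) ℝ] {ψ : C(ℝ × ℝ, ℝ)} {K : ℕ}

theorem pow_mul_le_embed_apply (hψ : HasStationaryKernel H ψ) (hψ0 : ∀ z, 0 ≤ ψ z)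
    (D : DataSet (ℝ × ℝ)) {j : Fin (K + 1)} (hj : Even (j : ℕ)) (a : Fin D.1) :
    D.output a ^ (j : ℕ) * ψ 0 ≤ embed H K D j (D.input a) := by
  rw [embed_apply H hψ]
  refine le_trans (le_of_eq ?_) (Finset.single_le_sum
    (f := fun i => powers K (D.output i) j * ψ (D.input a - D.input i))
    (fun i _ => mul_nonneg (hj.pow_nonneg _) (hψ0 _)) (Finset.mem_univ a))
  simp [powers]

/-- Along a filter on which the zeroth component of the encoding converges, the inputs stay
bounded: every input has to be within distance one of some input of a fixed data set. -/
theorem exists_bound_input (hψ : HasStationaryKernel H ψ) (hψ0 : ∀ z, 0 ≤ ψ z) (hpos : 0 < ψ 0)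
    (hsupp : ∀ z, 1 ≤ ‖z‖ → ψ z = 0) {ι : Type} {l : Filter ι} [l.NeBot]
    {D : ι → DataSet (ℝ × ℝ)} {f : H} (hD : Tendsto (fun i => embed H K (D i) 0) l (𝓝 f)) :
    ∃ C, ∀ᶠ i in l, ∀ a, ‖(D i).input a‖ ≤ C := by
  have hsq : 0 < √(ψ 0) := Real.sqrt_pos.2 hpos
  have hev : ∀ᶠ i in l, ‖embed H K (D i) 0 - f‖ < √(ψ 0) / 2 := by
    simpa [dist_eq_norm] using Metric.tendsto_nhds.1 hD (√(ψ 0) / 2) (half_pos hsq)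
  obtain ⟨i₀, hi₀⟩ := hev.exists
  refine ⟨1 + ∑ b, ‖(D i₀).input b‖, hev.mono fun i hi a => ?_⟩
  have hnear : ‖embed H K (D i) 0 - embed H K (D i₀) 0‖ < √(ψ 0) := by
    calc _ = ‖(embed H K (D i) 0 - f) - (embed H K (D i₀) 0 - f)‖ := by
          rw [sub_sub_sub_cancel_right]
      _ ≤ _ := norm_sub_le _ _
      _ < √(ψ 0) := by linarith
  have h1 := abs_apply_le hψ (embed H K (D i) 0 - embed H K (D i₀) 0) ((D i).input a)
  have h2 : |(embed H K (D i) 0 - embed H K (D i₀) 0) ((D i).input a)| < ψ 0 := by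
    refine h1.trans_lt ?_
    calc _ < √(ψ 0) * √(ψ 0) := mul_lt_mul_of_pos_right hnear hsq
      _ = ψ 0 := Real.mul_self_sqrt hpos.le
  have h3 := pow_mul_le_embed_apply (K := K) hψ hψ0 (D i) (j := 0) (by simp) a
  rw [RKHS.coe_sub, Pi.sub_apply] at h2
  have h4 : 0 < embed H K (D i₀) 0 ((D i).input a) := by
    have := (abs_lt.1 h2).2
    simp only [Fin.val_zero, pow_zero, one_mul] at h3
    linarith
  rw [embed_apply H hψ] at h4
  obtain ⟨b, -, hb⟩ := Finset.exists_ne_zero_of_sum_ne_zero h4.ne'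
  have h5 : ‖(D i).input a - (D i₀).input b‖ < 1 := by
    by_contra! h
    exact hb (by rw [hsupp _ h, mul_zero])
  have h6 : ‖(D i₀).input b‖ ≤ ∑ b, ‖(D i₀).input b‖ :=
    Finset.single_le_sum (f := fun b => ‖(D i₀).input b‖) (fun _ _ => norm_nonneg _)
      (Finset.mem_univ b)
  have h7 := norm_le_norm_add_norm_sub' ((D i).input a) ((D i₀).input b)
  linarith

/-- The component of order two of the encoding, if present, bounds the outputs. -/
theorem abs_output_le_of_order_two (hψ : HasStationaryKernel H ψ) (hψ0 : ∀ z, 0 ≤ ψ z)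
    (hpos : 0 < ψ 0) (D : DataSet (ℝ × ℝ)) {j : Fin (K + 1)} (hj : (j : ℕ) = 2) (a : Fin D.1) :
    |D.output a| ≤ 1 + ‖embed H K D j‖ * √(ψ 0) / ψ 0 := by
  have h1 := pow_mul_le_embed_apply (K := K) hψ hψ0 D (j := j) (by simp [hj]) a
  have h2 := (le_abs_self _).trans (abs_apply_le hψ (embed H K D j) (D.input a))
  have h3 : D.output a ^ 2 ≤ ‖embed H K D j‖ * √(ψ 0) / ψ 0 := by
    rw [le_div_iff₀ hpos, ← hj]
    exact h1.trans h2
  have h4 : |D.output a| ≤ 1 + D.output a ^ 2 := by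
    rw [← sq_abs]
    nlinarith [sq_nonneg (|D.output a| - 1), abs_nonneg (D.output a)]
  linarith

/-- For multiplicity one the component of order one bounds the outputs. If the largest output `y`
lies in `[2 ^ m, 2 ^ (m + 1))`, then the inputs are `δ m`-separated, so that the squared norm of
the component is at least `2⁻ᵐ y² ≥ y`. -/
theorem abs_output_le_of_separated (hψ : HasStationaryKernel H ψ) {S : Set (DataSet ℝ)}
    {δ : ℕ → ℝ}
    (hsep : ∀ m, ∀ D ∈ S, (∀ a, |D.input a| ≤ 2 ^ (m + 1) ∧ |D.output a| ≤ 2 ^ (m + 1)) →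
        ∀ a b, a ≠ b → δ m ≤ |D.input a - D.input b|)
    (hlow : ∀ (m : ℕ) {ι : Type} (s : Finset ι) (z : ι → ℝ × ℝ) (c : ι → ℝ),
        (∀ i ∈ s, ∀ j ∈ s, i ≠ j → δ m ≤ ‖z i - z j‖) →
        (1 / 2) ^ m * ∑ i ∈ s, c i ^ 2 ≤ ∑ i ∈ s, ∑ j ∈ s, c i * c j * ψ (z i - z j))
    {D : DataSet ℝ} (hD : D ∈ S) (τ : ℝ × ℝ) {R : ℝ} (hR : ∀ a, |D.input a| ≤ R)
    {j : Fin (K + 1)} (hj : (j : ℕ) = 1) (a : Fin D.1) :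
    |D.output a| ≤ max (max 1 R) (‖embed H K (D.duplicate.translate τ) j‖ ^ 2) := by
  have : Nonempty (Fin D.1) := ⟨a⟩
  obtain ⟨b, hb⟩ := Finite.exists_max fun a => |D.output a|
  refine (hb a).trans ?_
  by_contra! hlt
  obtain ⟨⟨h1, hyR⟩, hy⟩ : (1 < |D.output b| ∧ R < |D.output b|) ∧ _ := by
    simpa only [max_lt_iff] using hlt
  obtain ⟨m, hm1, hm2⟩ := exists_nat_pow_near h1.le (one_lt_two : (1 : ℝ) < 2)
  have hs := hsep m D hD fun a =>
    ⟨(hR a).trans (hyR.le.trans hm2.le), (hb a).trans hm2.le⟩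
  have h2 := hlow m Finset.univ (fun i => (D.input i, D.input i) + τ) D.output
    fun i _ i' _ hii' => by
      refine (hs i i' hii').trans (le_of_eq ?_)
      rw [add_sub_add_right_eq_sub, Prod.mk_sub_mk, Prod.norm_mk, max_self, Real.norm_eq_abs]
  rw [← norm_sum_kerFun_sq hψ] at h2
  have h3 : embed H K (D.duplicate.translate τ) j
      = ∑ i, D.output i • RKHS.kerFun H ((D.input i, D.input i) + τ) 1 := by
    simp only [embed, powers, hj, pow_one]
    rfl
  rw [← h3] at h2
  have h4 : D.output b ^ 2 ≤ ∑ i, D.output i ^ 2 :=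
    Finset.single_le_sum (f := fun i => D.output i ^ 2) (fun _ _ => sq_nonneg _)
      (Finset.mem_univ b)
  have h5 : |D.output b| ≤ (1 / 2) ^ m * D.output b ^ 2 := by
    rw [← sq_abs, one_div, inv_pow, inv_mul_eq_div, le_div_iff₀ (by positivity), sq]
    exact mul_le_mul_of_nonneg_left hm1 (abs_nonneg _)
  have h6 := mul_le_mul_of_nonneg_left h4 (show (0 : ℝ) ≤ (1 / 2) ^ m by positivity)
  linarith

end Bounds

/-! ### Codes of data sets -/

theorem _root_.Ultrafilter.exists_tendsto_of_norm_le {ι E : Type*} [SeminormedAddCommGroup E]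
    [ProperSpace E] (𝒰 : Ultrafilter ι) {f : ι → E} {C : ℝ} (hf : ∀ᶠ i in 𝒰, ‖f i‖ ≤ C) :
    ∃ a, Tendsto f 𝒰 (𝓝 a) := by
  obtain ⟨a, -, ha⟩ := (isCompact_closedBall (0 : E) C).ultrafilter_le_nhds (𝒰.map f)
    (le_principal_iff.2 (hf.mono fun i hi => by simpa using hi))
  exact ⟨a, ha⟩

theorem HasMultiplicity.pos {S : Set (DataSet ℝ)} {K : ℕ} (hS : HasMultiplicity S K)
    {D : DataSet ℝ} (hD : D ∈ S) (a : Fin D.1) : 0 < K :=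
  ((Set.ncard_pos (Set.toFinite {i | D.input i = D.input a})).2 ⟨a, rfl⟩).trans_le
    (hS D hD (D.input a))

section Code

variable (H : Type) [NormedAddCommGroup H] [InnerProductSpace ℝ H] [CompleteSpace H]
  [RKHS ℝ H (ℝ × ℝ) ℝ]

/-- The code `T_τ E(D)` of a data set `D` with real inputs, translated by `τ`. For nonempty `D` it
is `E₂ (dup D + τ)`; for the empty data set this holds for `τ = 0` only, because `E₂` shifts `h` by
the centroid, which is then `0`. -/
noncomputable def code (h : C(ℝ × ℝ, ℝ)) (K : ℕ) (D : DataSet ℝ) (τ : ℝ × ℝ) : Code H K :=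
  (embed H K (D.duplicate.translate τ), shift τ h)

variable {H} {h : C(ℝ × ℝ, ℝ)} {K : ℕ}

theorem encode_eq_code (D : DataSet ℝ) : encode H h K D = code H h K D 0 := by
  simp [encode, code, shift_zero, DataSet.translate, DataSet.input, DataSet.output,
    DataSet.duplicate]

theorem encodeTwo_eq_code (hdiag : IsDiagonallyInvariant h) {D : DataSet ℝ} (hD : D.1 ≠ 0)
    (τ : ℝ × ℝ) : encodeTwo H h K (D.duplicate.translate τ) = code H h K D τ := by
  have hn : (D.1 : ℝ) ≠ 0 := Nat.cast_ne_zero.2 hD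
  have hc : (D.duplicate.translate τ).centroid
      = τ + ((D.1 : ℝ)⁻¹ * ∑ i, D.input i, (D.1 : ℝ)⁻¹ * ∑ i, D.input i) := by
    change (D.1 : ℝ)⁻¹ • ∑ i : Fin D.1, ((D.input i, D.input i) + τ) = _
    rw [Finset.sum_add_distrib, Finset.sum_const, Finset.card_univ, Fintype.card_fin, smul_add,
      ← Nat.cast_smul_eq_nsmul ℝ, inv_smul_smul₀ hn, add_comm]
    congr 1
    ext <;> simp [Prod.fst_sum, Prod.snd_sum]
  rw [encodeTwo, code, hc, ← shift_shift, hdiag]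

theorem encodeTwo_eq_code_zero {D : DataSet ℝ} (hD : D.1 = 0) (τ : ℝ × ℝ) :
    encodeTwo H h K (D.duplicate.translate τ) = code H h K D 0 := by
  obtain ⟨n, d⟩ := D
  obtain rfl : n = 0 := hD
  have : (DataSet.translate (DataSet.duplicate ⟨0, d⟩) τ).centroid = 0 := by
    simp [DataSet.centroid, DataSet.translate, DataSet.duplicate]
  rw [encodeTwo, code, this]
  congr 1

/-- The image of `E₂` consists of the codes of the data sets in `S`, where only the trivial
translation is allowed for the empty data set. -/
theorem mem_image_encodeTwo (hdiag : IsDiagonallyInvariant h) {S : Set (DataSet ℝ)}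
    {x : Code H K} : x ∈ encodeTwo H h K '' duplicated S ↔
      ∃ D ∈ S, ∃ τ, (D.1 = 0 → τ = 0) ∧ x = code H h K D τ := by
  constructor
  · rintro ⟨-, ⟨D, hD, τ, rfl⟩, rfl⟩
    by_cases h0 : D.1 = 0
    · exact ⟨D, hD, 0, fun _ => rfl, encodeTwo_eq_code_zero h0 τ⟩
    · exact ⟨D, hD, τ, fun h => absurd h h0, encodeTwo_eq_code hdiag h0 τ⟩
  · rintro ⟨D, hD, τ, hτ, rfl⟩
    refine ⟨_, ⟨D, hD, τ, rfl⟩, ?_⟩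
    by_cases h0 : D.1 = 0
    · rw [encodeTwo_eq_code_zero h0, hτ h0]
    · exact encodeTwo_eq_code hdiag h0 τ

theorem code_translate (hdiag : IsDiagonallyInvariant h) (D : DataSet ℝ) (t : ℝ) (τ : ℝ × ℝ) :
    code H h K (D.translate t) τ = code H h K D (τ + (t, t)) := by
  rw [code, code, ← shift_shift, hdiag]
  congr 2
  simp only [DataSet.translate, DataSet.duplicate, DataSet.input, DataSet.output]
  congr 1
  funext i
  ext <;> simp <;> ring

theorem IsTranslate.eq_code {ψ : C(ℝ × ℝ, ℝ)} (hψ : HasStationaryKernel H ψ) {D : DataSet ℝ}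
    {σ τ : ℝ × ℝ} {x : Code H K} (hx : IsTranslate σ (code H h K D τ) x) :
    x = code H h K D (σ + τ) := by
  refine Prod.ext (funext fun j => RKHS.ext fun z => ?_) ?_
  · rw [hx.1]
    simp only [code, embed_translate_apply hψ, sub_sub]
  · rw [hx.2]
    exact shift_shift _ _ _

theorem continuous_code {ψ : C(ℝ × ℝ, ℝ)} (hψ : HasStationaryKernel H ψ) (n : ℕ) :
    Continuous fun p : (Fin n → ℝ × ℝ) × (ℝ × ℝ) => code H h K ⟨n, p.1⟩ p.2 := by
  have hker := continuous_kerFun hψ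
  refine Continuous.prodMk ?_ (continuous_shift.comp (continuous_snd.prodMk continuous_const))
  refine continuous_pi fun j => ?_
  change Continuous fun p : (Fin n → ℝ × ℝ) × (ℝ × ℝ) => ∑ i : Fin n,
    (p.1 i).2 ^ (j : ℕ) • RKHS.kerFun H (((p.1 i).1, (p.1 i).1) + p.2) (1 : ℝ)
  refine continuous_finsetSum _ fun i _ => ?_
  have h1 : Continuous fun p : (Fin n → ℝ × ℝ) × (ℝ × ℝ) => (p.1 i).2 ^ (j : ℕ) := by fun_prop
  have h2 : Continuous fun p : (Fin n → ℝ × ℝ) × (ℝ × ℝ) => ((p.1 i).1, (p.1 i).1) + p.2 := by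
    fun_prop
  exact h1.smul (hker.comp h2)

end Code

/-! ### Uniqueness of the data set of a code -/

section WellDefined

variable {H : Type} [NormedAddCommGroup H] [InnerProductSpace ℝ H] [CompleteSpace H]
  [RKHS ℝ H (ℝ × ℝ) ℝ] {h : C(ℝ × ℝ, ℝ)} {K : ℕ}

/-- Equal codes belong to data sets that agree up to a diagonal translation and a permutation.
The translation is read off from the inputs, or from `h` if there are none. -/
theorem shift_eq_of_code_eq {S : Set (DataSet ℝ)} {k : DataSet ℝ → C(ℝ × ℝ, ℝ)}
    (hkTE : ∀ (D : DataSet ℝ) (τ : ℝ), k (D.translate τ) = shift (τ, τ) (k D))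
    (hStrans : ∀ D ∈ S, ∀ τ : ℝ, D.translate τ ∈ S) (hSmult : HasMultiplicity S K)
    (hkperm : ∀ D ∈ S, ∀ σ : Equiv.Perm (Fin D.1), k (D.permute σ) = k D)
    (hdisc : IsPerpDiscriminating h)
    (hli : LinearIndependent ℝ fun z : ℝ × ℝ => RKHS.kerFun H z (1 : ℝ))
    {D D' : DataSet ℝ} (hD : D ∈ S) {τ τ' : ℝ × ℝ}
    (hcode : code H h K D τ = code H h K D' τ') : shift τ (k D) = shift τ' (k D') := by
  have hmult : ∀ w, {i | (D.duplicate.translate τ).input i = w}.ncard ≤ K := fun w => by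
    refine (Set.ncard_le_ncard (fun i hi => ?_) (Set.toFinite _)).trans
      (hSmult D hD (w.1 - τ.1))
    have : D.input i + τ.1 = w.1 := congrArg Prod.fst hi
    exact eq_sub_of_add_eq this
  obtain ⟨n, d⟩ := D
  obtain ⟨n', d'⟩ := D'
  obtain ⟨e, he⟩ : ∃ e : Fin n ≃ Fin n', ∀ i, (((d' (e i)).1, (d' (e i)).1) + τ', (d' (e i)).2)
      = (((d i).1, (d i).1) + τ, (d i).2) :=
    exists_equiv_of_embed_eq hli hmult (congrArg Prod.fst hcode)
  obtain rfl : n = n' := by simpa using Fintype.card_congr e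
  obtain ⟨t, rfl⟩ : ∃ t : ℝ, τ = τ' + (t, t) := by
    rcases n.eq_zero_or_pos with rfl | hn
    · refine sub_eq_diag_of_perp_eq ?_
      by_contra hne
      exact hdisc _ _ hne (congrArg Prod.snd hcode).symm
    · have := he ⟨0, hn⟩
      simp only [Prod.ext_iff, Prod.fst_add, Prod.snd_add] at this
      refine ⟨(d' (e ⟨0, hn⟩)).1 - (d ⟨0, hn⟩).1, Prod.ext ?_ ?_⟩
      · simp only [Prod.fst_add]
        linarith [this.1.1]
      · simp only [Prod.snd_add]
        linarith [this.1.2]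
  have hD' : (⟨n, d'⟩ : DataSet ℝ) = (DataSet.translate ⟨n, d⟩ t).permute e.symm := by
    simp only [DataSet.permute, DataSet.translate, DataSet.input, DataSet.output]
    congr 1
    funext i
    have := he (e.symm i)
    simp only [Equiv.apply_symm_apply, Prod.ext_iff, Prod.fst_add, Prod.snd_add] at this
    refine Prod.ext ?_ this.2
    change (d' i).1 = (d (e.symm i)).1 + t
    linarith [this.1.1]
  have hk' : k ⟨n, d'⟩ = k (DataSet.translate ⟨n, d⟩ t) :=
    (congrArg k hD').trans (hkperm _ (hStrans _ hD t) e.symm)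
  rw [hk', hkTE, shift_shift]

end WellDefined

/-! ### Limits of codes -/

section Limits

variable {H : Type} [NormedAddCommGroup H] [InnerProductSpace ℝ H] [CompleteSpace H]
  [RKHS ℝ H (ℝ × ℝ) ℝ] {h : C(ℝ × ℝ, ℝ)} {K : ℕ} {ψ : C(ℝ × ℝ, ℝ)} {S : Set (DataSet ℝ)}
  {δ : ℕ → ℝ}

/-- Convergence of codes of nonempty data sets of constant size forces the inputs, the outputs and
the translations to converge. The ambiguity of a code under diagonal translations is removed by
requiring one input to vanish. -/
theorem exists_tendsto_of_tendsto_code (hψ : HasStationaryKernel H ψ) (hψ0 : ∀ z, 0 ≤ ψ z)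
    (hpos : 0 < ψ 0) (hsupp : ∀ z, 1 ≤ ‖z‖ → ψ z = 0) (hSmult : HasMultiplicity S K)
    (hsep : K = 1 → ∀ m, ∀ D ∈ S,
      (∀ a, |D.input a| ≤ 2 ^ (m + 1) ∧ |D.output a| ≤ 2 ^ (m + 1)) →
        ∀ a b, a ≠ b → δ m ≤ |D.input a - D.input b|)
    (hlow : ∀ (m : ℕ) {ι : Type} (s : Finset ι) (z : ι → ℝ × ℝ) (c : ι → ℝ),
        (∀ i ∈ s, ∀ j ∈ s, i ≠ j → δ m ≤ ‖z i - z j‖) →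
        (1 / 2) ^ m * ∑ i ∈ s, c i ^ 2 ≤ ∑ i ∈ s, ∑ j ∈ s, c i * c j * ψ (z i - z j))
    {ι : Type} (𝒰 : Ultrafilter ι) {n : ℕ} (a₀ : Fin n) {d : ι → Fin n → ℝ × ℝ}
    {τ : ι → ℝ × ℝ} (hd : ∀ᶠ i in 𝒰, (⟨n, d i⟩ : DataSet ℝ) ∈ S)
    (hd₀ : ∀ᶠ i in 𝒰, (d i a₀).1 = 0) {e : Code H K}
    (he : Tendsto (fun i => code H h K ⟨n, d i⟩ (τ i)) 𝒰 (𝓝 e)) :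
    ∃ d' τ', Tendsto d 𝒰 (𝓝 d') ∧ Tendsto τ 𝒰 (𝓝 τ') := by
  have hcomp : ∀ j, Tendsto
      (fun i => embed H K ((DataSet.duplicate ⟨n, d i⟩).translate (τ i)) j) 𝒰 (𝓝 (e.1 j)) :=
    fun j => ((continuous_apply j).tendsto _).comp ((continuous_fst.tendsto _).comp he)
  obtain ⟨C, hC⟩ := exists_bound_input hψ hψ0 hpos hsupp (hcomp 0)
  replace hC : ∀ᶠ i in 𝒰, ∀ a : Fin n, ‖(((d i a).1, (d i a).1) : ℝ × ℝ) + τ i‖ ≤ C := hC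
  have hτ : ∀ᶠ i in 𝒰, ‖τ i‖ ≤ C := by
    filter_upwards [hC, hd₀] with i hi hi₀
    have h1 := hi a₀
    rwa [hi₀, Prod.mk_zero_zero, zero_add] at h1
  have hin : ∀ᶠ i in 𝒰, ∀ a, |(d i a).1| ≤ C + C := by
    filter_upwards [hC, hτ] with i hi hτi a
    have h1 := norm_le_add_norm_add (((d i a).1, (d i a).1) : ℝ × ℝ) (τ i)
    rw [Prod.norm_mk, max_self, Real.norm_eq_abs] at h1
    linarith [hi a]
  have hnorm : ∀ j, ∃ M, ∀ᶠ i in 𝒰,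
      ‖embed H K ((DataSet.duplicate ⟨n, d i⟩).translate (τ i)) j‖ ≤ M := fun j =>
    ⟨‖e.1 j‖ + 1, ((hcomp j).norm.eventually (gt_mem_nhds (lt_add_one _))).mono fun _ h => h.le⟩
  have hout : ∃ B, ∀ᶠ i in 𝒰, ∀ a, |(d i a).2| ≤ B := by
    obtain ⟨i₀, hi₀⟩ := hd.exists
    have hK : 0 < K := hSmult.pos hi₀ a₀
    rcases Nat.lt_or_ge 1 K with hK2 | hK1
    · obtain ⟨M, hM⟩ := hnorm ⟨2, by omega⟩
      refine ⟨1 + M * √(ψ 0) / ψ 0, hM.mono fun i hi a => ?_⟩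
      refine (abs_output_le_of_order_two (K := K) hψ hψ0 hpos
        ((DataSet.duplicate ⟨n, d i⟩).translate (τ i)) (j := ⟨2, by omega⟩) rfl a).trans ?_
      gcongr
    · obtain rfl : K = 1 := by omega
      obtain ⟨M, hM⟩ := hnorm 1
      refine ⟨max (max 1 (C + C)) (M ^ 2), ?_⟩
      filter_upwards [hM, hd, hin] with i hi hdi hini a
      refine (abs_output_le_of_separated (K := 1) hψ (hsep rfl) hlow hdi (τ i) hini
        (j := 1) rfl a).trans ?_
      gcongr
  obtain ⟨B, hB⟩ := hout
  obtain ⟨τ', hτ'⟩ := 𝒰.exists_tendsto_of_norm_le hτ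
  have hdn : ∀ᶠ i in 𝒰, ‖d i‖ ≤ max (C + C) B := by
    filter_upwards [hin, hB] with i hini hBi
    have : Nonempty (Fin n) := ⟨a₀⟩
    exact (pi_norm_le_iff_of_nonempty _).2 fun a => max_le_max (hini a) (hBi a)
  obtain ⟨d', hd'⟩ := 𝒰.exists_tendsto_of_norm_le hdn
  exact ⟨d', τ', hd', hτ'⟩

/-- The map from data sets and translations to codes is proper up to the choice of representatives:
an ultrafilter of codes that converges lifts to convergent data sets and translations. -/
theorem exists_lift_of_ultrafilter (hψ : HasStationaryKernel H ψ) (hψ0 : ∀ z, 0 ≤ ψ z)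
    (hpos : 0 < ψ 0) (hsupp : ∀ z, 1 ≤ ‖z‖ → ψ z = 0) (hSmult : HasMultiplicity S K)
    {N : ℕ} (hsize : ∀ D ∈ S, D.size ≤ N) (hStrans : ∀ D ∈ S, ∀ τ : ℝ, D.translate τ ∈ S)
    (hdiag : IsDiagonallyInvariant h)
    (hsep : K = 1 → ∀ m, ∀ D ∈ S,
      (∀ a, |D.input a| ≤ 2 ^ (m + 1) ∧ |D.output a| ≤ 2 ^ (m + 1)) →
        ∀ a b, a ≠ b → δ m ≤ |D.input a - D.input b|)
    (hlow : ∀ (m : ℕ) {ι : Type} (s : Finset ι) (z : ι → ℝ × ℝ) (c : ι → ℝ),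
        (∀ i ∈ s, ∀ j ∈ s, i ≠ j → δ m ≤ ‖z i - z j‖) →
        (1 / 2) ^ m * ∑ i ∈ s, c i ^ 2 ≤ ∑ i ∈ s, ∑ j ∈ s, c i * c j * ψ (z i - z j))
    (𝒰 : Ultrafilter (Code H K)) (h𝒰 : encodeTwo H h K '' duplicated S ∈ 𝒰) {e : Code H K}
    (he : (𝒰 : Filter (Code H K)) ≤ 𝓝 e) :
    ∃ (n : ℕ) (d : Code H K → Fin n → ℝ × ℝ) (τ : Code H K → ℝ × ℝ) (d' : Fin n → ℝ × ℝ)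
      (τ' : ℝ × ℝ), (∀ᶠ x in 𝒰, (⟨n, d x⟩ : DataSet ℝ) ∈ S ∧ x = code H h K ⟨n, d x⟩ (τ x)) ∧
        Tendsto d 𝒰 (𝓝 d') ∧ Tendsto τ 𝒰 (𝓝 τ') ∧ (n = 0 → τ' = 0) := by
  have hex : ∀ᶠ x in 𝒰, ∃ n ∈ Set.Iic N, ∃ (d : Fin n → ℝ × ℝ) (τ : ℝ × ℝ),
      ((⟨n, d⟩ : DataSet ℝ) ∈ S ∧ x = code H h K ⟨n, d⟩ τ) ∧ (n = 0 → τ = 0) ∧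
        ∀ hn : 0 < n, (d ⟨0, hn⟩).1 = 0 := by
    filter_upwards [h𝒰] with x hx
    obtain ⟨⟨n, d⟩, hD, τ, hτ, rfl⟩ := (mem_image_encodeTwo hdiag).1 hx
    refine ⟨n, hsize _ hD, ?_⟩
    rcases n.eq_zero_or_pos with rfl | hn
    · exact ⟨d, τ, ⟨hD, rfl⟩, hτ, fun hn => absurd hn (lt_irrefl 0)⟩
    -- Moving the first input to zero compensates for the diagonal part of the translation.
    · refine ⟨fun i => ((d i).1 + -(d ⟨0, hn⟩).1, (d i).2), τ + ((d ⟨0, hn⟩).1, (d ⟨0, hn⟩).1),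
        ⟨hStrans _ hD (-(d ⟨0, hn⟩).1), ?_⟩, fun h0 => absurd h0 hn.ne',
        fun _ => add_neg_cancel _⟩
      refine Eq.trans ?_ (code_translate hdiag ⟨n, d⟩ (-(d ⟨0, hn⟩).1) _).symm
      congr 1
      ext <;> simp
  obtain ⟨n, -, hn⟩ := (Ultrafilter.eventually_exists_mem_iff (Set.finite_Iic N)).1 hex
  have hsel : ∀ x : Code H K, ∃ (d : Fin n → ℝ × ℝ) (τ : ℝ × ℝ),
      (∃ (d : Fin n → ℝ × ℝ) (τ : ℝ × ℝ),
      ((⟨n, d⟩ : DataSet ℝ) ∈ S ∧ x = code H h K ⟨n, d⟩ τ) ∧ (n = 0 → τ = 0) ∧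
        ∀ hn : 0 < n, (d ⟨0, hn⟩).1 = 0) →
      ((⟨n, d⟩ : DataSet ℝ) ∈ S ∧ x = code H h K ⟨n, d⟩ τ) ∧ (n = 0 → τ = 0) ∧
        ∀ hn : 0 < n, (d ⟨0, hn⟩).1 = 0 := by
    intro x
    by_cases hx : ∃ (d : Fin n → ℝ × ℝ) (τ : ℝ × ℝ),
      ((⟨n, d⟩ : DataSet ℝ) ∈ S ∧ x = code H h K ⟨n, d⟩ τ) ∧ (n = 0 → τ = 0) ∧
        ∀ hn : 0 < n, (d ⟨0, hn⟩).1 = 0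
    · obtain ⟨d, τ, hdτ⟩ := hx
      exact ⟨d, τ, fun _ => hdτ⟩
    · exact ⟨0, 0, fun h => absurd h hx⟩
  choose d τ hdτ using hsel
  have hall : ∀ᶠ x in 𝒰, ((⟨n, d x⟩ : DataSet ℝ) ∈ S ∧ x = code H h K ⟨n, d x⟩ (τ x)) ∧
      (n = 0 → τ x = 0) ∧ ∀ hn : 0 < n, (d x ⟨0, hn⟩).1 = 0 := hn.mono hdτ
  rcases n.eq_zero_or_pos with rfl | hn0
  · refine ⟨0, d, τ, 0, 0, hall.mono fun x hx => hx.1, ?_, ?_, fun _ => rfl⟩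
    · exact tendsto_const_nhds.congr fun x => Subsingleton.elim _ _
    · exact tendsto_const_nhds.congr' (hall.mono fun x hx => (hx.2.1 rfl).symm)
  · obtain ⟨d', τ', hd', hτ'⟩ := exists_tendsto_of_tendsto_code (h := h) hψ hψ0 hpos hsupp hSmult
      hsep hlow 𝒰 ⟨0, hn0⟩ (d := d) (τ := τ) (e := e) (hall.mono fun x hx => hx.1.1)
      (hall.mono fun x hx => hx.2.2 hn0)
      ((tendsto_id'.2 he).congr' (hall.mono fun x hx => hx.1.2))
    exact ⟨n, d, τ, d', τ', hall.mono fun x hx => hx.1, hd', hτ', fun h0 => absurd h0 hn0.ne'⟩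

end Limits

end GNP

theorem mainTheorem2
    (k : GNP.DataSet ℝ → GNP.PSDFun) (hk : Continuous k)
    (hkTE : ∀ (D : GNP.DataSet ℝ) (τ : ℝ),
      (k (D.translate τ) : C(ℝ × ℝ, ℝ)) = GNP.shift (τ, τ) (k D))
    (S : Set (GNP.DataSet ℝ)) (hSclosed : IsClosed S)
    (hSperm : ∀ D ∈ S, ∀ σ : Equiv.Perm (Fin D.1), D.permute σ ∈ S)
    (hStrans : ∀ D ∈ S, ∀ τ : ℝ, D.translate τ ∈ S)
    (hSsize : ∃ N : ℕ, ∀ D ∈ S, D.size ≤ N)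
    (K : ℕ) (hSmult : GNP.HasMultiplicity S K)
    (hkperm : ∀ D ∈ S, ∀ σ : Equiv.Perm (Fin D.1), k (D.permute σ) = k D)
    (h : C(ℝ × ℝ, ℝ)) (hdisc : GNP.IsPerpDiscriminating h)
    (hdiag : GNP.IsDiagonallyInvariant h) :
    ∃ (H : Type) (_ : NormedAddCommGroup H) (_ : InnerProductSpace ℝ H) (_ : CompleteSpace H)
      (_ : RKHS ℝ H (ℝ × ℝ) ℝ) (ψ : C(ℝ × ℝ, ℝ)) (ρ : GNP.Code H K → C(ℝ × ℝ, ℝ)),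
      GNP.HasStationaryKernel H ψ ∧
      IsClosed (GNP.encodeTwo H h K '' GNP.duplicated S) ∧
      ContinuousOn ρ (GNP.encodeTwo H h K '' GNP.duplicated S) ∧
      GNP.IsEquivariantOn ρ (GNP.translates (GNP.encodeTwo H h K '' GNP.duplicated S)) ∧
      ∀ D ∈ S, GNP.encode H h K D ∈ GNP.encodeTwo H h K '' GNP.duplicated S ∧
        (k D : C(ℝ × ℝ, ℝ)) = ρ (GNP.encode H h K D) := by
  classical
  obtain ⟨N, hN⟩ := hSsize
  obtain ⟨δ, hδ0, hδ1, hδ, hsep⟩ := GNP.exists_scales hSclosed hN hSmult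
  obtain ⟨ψ, hψPT, hψ0, hpos, hsupp, hlow⟩ := GNP.exists_profile δ hδ0 hδ1
  obtain ⟨H, i₁, i₂, i₃, i₄, hψ⟩ := GNP.exists_rkhs ψ hψPT
  have hli := GNP.linearIndependent_kerFun hψ hδ hlow
  -- `ρ` reads off any data set with the given code; its value outside the codes plays no role.
  let ρ : GNP.Code H K → C(ℝ × ℝ, ℝ) := fun x =>
    if hx : ∃ p : GNP.DataSet ℝ × (ℝ × ℝ), p.1 ∈ S ∧ x = GNP.code H h K p.1 p.2 then
      GNP.shift hx.choose.2 (k hx.choose.1) else 0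
  have hρ : ∀ D ∈ S, ∀ τ, ρ (GNP.code H h K D τ) = GNP.shift τ (k D) := by
    intro D hD τ
    have hx : ∃ p : GNP.DataSet ℝ × (ℝ × ℝ), p.1 ∈ S ∧
      GNP.code H h K D τ = GNP.code H h K p.1 p.2 := ⟨(D, τ), hD, rfl⟩
    simp only [ρ, dif_pos hx]
    exact (GNP.shift_eq_of_code_eq (k := fun D => (k D : C(ℝ × ℝ, ℝ))) hkTE hStrans hSmult
      (fun D hD σ => congrArg Subtype.val (hkperm D hD σ)) hdisc hli hD hx.choose_spec.2).symm
  -- Limits of codes along ultrafilters give closedness and continuity at the same time.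
  have hlim : ∀ (𝒰 : Ultrafilter (GNP.Code H K)) (e : GNP.Code H K),
      (𝒰 : Filter (GNP.Code H K)) ≤ nhds e → GNP.encodeTwo H h K '' GNP.duplicated S ∈ 𝒰 →
      e ∈ GNP.encodeTwo H h K '' GNP.duplicated S ∧ Filter.Tendsto ρ 𝒰 (nhds (ρ e)) := by
    intro 𝒰 e he h𝒰
    obtain ⟨n, d, τ, d', τ', hall, hd', hτ', hn⟩ := GNP.exists_lift_of_ultrafilter hψ hψ0 hpos
      hsupp hSmult hN hStrans hdiag hsep hlow 𝒰 h𝒰 he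
    have hD : Filter.Tendsto (fun x => (⟨n, d x⟩ : GNP.DataSet ℝ)) 𝒰 (nhds ⟨n, d'⟩) :=
      ((continuous_sigmaMk (σ := fun n => Fin n → ℝ × ℝ)).tendsto d').comp hd'
    have hDS : (⟨n, d'⟩ : GNP.DataSet ℝ) ∈ S :=
      hSclosed.mem_of_tendsto hD (hall.mono fun x hx => hx.1)
    have hcode := ((GNP.continuous_code (h := h) (K := K) hψ n).tendsto (d', τ')).comp
      (hd'.prodMk_nhds hτ')
    obtain rfl : e = GNP.code H h K ⟨n, d'⟩ τ' :=
      tendsto_nhds_unique (Filter.tendsto_id'.2 he)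
        (hcode.congr' (hall.mono fun x hx => hx.2.symm))
    refine ⟨(GNP.mem_image_encodeTwo hdiag).2 ⟨_, hDS, τ', hn, rfl⟩, ?_⟩
    rw [hρ _ hDS]
    have hkD := ((continuous_subtype_val.comp hk).tendsto _).comp hD
    refine ((GNP.continuous_shift.tendsto (τ', (k ⟨n, d'⟩ : C(ℝ × ℝ, ℝ)))).comp
      (hτ'.prodMk_nhds hkD)).congr' (hall.mono fun x hx => ?_)
    conv_rhs => rw [hx.2, hρ _ hx.1]
    rfl
  refine ⟨H, i₁, i₂, i₃, i₄, ψ, ρ, hψ, ?_, ?_, ?_, ?_⟩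
  · exact isClosed_iff_ultrafilter.2 fun e 𝒰 he h𝒰 => (hlim 𝒰 e he h𝒰).1
  · refine fun e _ => Filter.tendsto_iff_ultrafilter _ _ _ |>.2 fun 𝒰 h𝒰 => ?_
    rw [nhdsWithin, le_inf_iff, Filter.le_principal_iff] at h𝒰
    exact (hlim 𝒰 e h𝒰.1 h𝒰.2).2
  · rintro x ⟨x₀, hx₀, σ, hσ⟩ y - τ hτ
    obtain ⟨D, hD, τ₀, -, rfl⟩ := (GNP.mem_image_encodeTwo hdiag).1 hx₀
    obtain rfl := hσ.eq_code hψ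
    obtain rfl := hτ.eq_code hψ
    rw [hρ D hD, hρ D hD, GNP.shift_shift]
  · intro D hD
    rw [GNP.encode_eq_code]
    refine ⟨(GNP.mem_image_encodeTwo hdiag).2 ⟨D, hD, 0, fun _ => rfl, rfl⟩, ?_⟩
    rw [hρ D hD, GNP.shift_zero]
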